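/- **Theorem (Conformal generation risk under distribution shifts).** Let $\mathcal D$ and $\mathcal Q$ be probability distributions on $\mathcal X\times\mathcal Y$ (calibration and test distribution), let $T_\lambda$ be a fixed generation model and let $R$ be a (measurable) risk function with values in $[0,1]$; for $z=(x,y)$ write $R(z)=R(T_\lambda(x),y)$. Let $N=N_{\rm cal}\ge 2$, let $Z_1,\dots,Z_N$ be i.i.d. with law $\mathcal D$, and let $0<\delta<1$. Suppose that the test pair $(X_{\rm test},Y_{\rm test})$ is drawn from $\mathcal Q$ and that $H(\mathcal D,\mathcal Q)\le\rho$, where $$H(\mathcal D,\mathcal Q)=\sqrt{\tfrac12\int\Big(\sqrt{\tfrac{d\mathcal D}{d\mu}}-\sqrt{\tfrac{d\mathcal Q}{d\mu}}\Big)^2d\mu}$$ is the Hellinger distance ($\mu$ being a measure that dominates both). Put $$\hat R=\frac1N\sum_{i=1}^N R(Z_i),\qquad \hat V=\frac1{N(N-1)}\sum_{1\le i<j\le N}\big(R(Z_i)-R(Z_j)\big)^2,$$ $$\overline{\hat R_\rho}=\hat R+\rho^2(2-\rho^2)(1-\hat R)+2\rho(1-\rho^2)\sqrt{2-\rho^2}\,\sqrt{\hat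 V}+(1-\rho^2)\left(\frac{1-\rho^2}{\sqrt{2N}}+\frac{2\sqrt2\,\rho\sqrt{2-\rho^2}}{\sqrt{N-1}}\right)\sqrt{\ln(4/\delta)}+\sqrt{\frac{\ln(8/\delta)}{2N}}$$ and $$\hat\alpha(\rho)=\min\left\{h^{-1}\!\left(\frac{\ln(8/\delta)}{N};\overline{\hat R_\rho}\right),\ \Phi_{\rm bin}^{-1}\!\left(\frac{\delta}{8e};N,\overline{\hat R_\rho}\right)\right\},$$ where a value $\overline{\hat R_\rho}>1$ is replaced by $1$ in the definition of $\hat\alpha(\rho)$. Here $h(a,b)=a\ln\frac ab+(1-a)\ln\frac{1-a}{1-b}$ (with the usual conventions $0\ln 0=0$ and $h(a,1)=+\infty$ for $a<1$), $h^{-1}(c;a)=\sup\{b\in[a,1]:h(a,b)\le c\}$ is its partial inverse, so that $h^{-1}(h(a,b);a)=b$ for $b\ge a$, and $\Phi_{\rm bin}^{-1}(q;n,r)=\sup\{p\in[0,1]:\mathbb P(\mathrm{Bin}(n,p)\le\lceil nr\rceil)\ge q\}$ is the inverse of the binomial distribution function in its success probability. Consider the condition $$\rho^2\le 1-\left[1+\left(\frac{\hat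 R-1+\sqrt{\ln(4/\delta)/(2N)}}{\sqrt{\hat V}+\sqrt{2\ln(2/\delta)/(N-1)}}\right)^2\right]^{-2}\qquad(\ast)$$ on the radius $\rho$. Then, with probability at least $1-\delta$ over the calibration sample $Z_1,\dots,Z_N$, the risk of $T_\lambda$ under the shifted test distribution is at most $\hat\alpha(\rho)$ whenever $(\ast)$ holds: $$\mathbb P\Big[\ (\ast)\ \Longrightarrow\ \mathbb E_{(X_{\rm test},Y_{\rm test})\sim\mathcal Q}\big[R(T_\lambda(X_{\rm test}),Y_{\rm test})\big]\le\hat\alpha(\rho)\ \Big]\ \ge\ 1-\delta .$$ -/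

import Mathlib

open MeasureTheory ProbabilityTheory

namespace ConformalShift

noncomputable section

/-- The Hellinger distance `H(D, Q) = √(½ ∫ (√(dD/dμ) - √(dQ/dμ))² dμ)`, taken with respect to
the dominating reference measure `μ = D + Q` (its value does not depend on the choice of a
dominating measure). -/
def hellinger {α : Type*} [MeasurableSpace α] (D Q : Measure α) : ℝ :=
  √((1 / 2) * ∫ z, (√(D.rnDeriv (D + Q) z).toReal - √(Q.rnDeriv (D + Q) z).toReal) ^ 2 ∂(D + Q))

/-- The binary Kullback-Leibler divergence
`h(a, b) = a log (a / b) + (1 - a) log ((1 - a) / (1 - b))` for `a, b ∈ [0, 1]`, with the usual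
conventions: `0 log (0 / b) = 0`, and the value is `+∞` if `b = 0 ≠ a` or `b = 1 ≠ a`. -/
def klBin (a b : ℝ) : EReal :=
  open scoped Classical in
  if (b = 0 ∧ a ≠ 0) ∨ (b = 1 ∧ a ≠ 1) then ⊤
  else ((a * Real.log (a / b) + (1 - a) * Real.log ((1 - a) / (1 - b)) : ℝ) : EReal)

/-- The partial (upper) inverse `h⁻¹(c; a) = sup {b ∈ [a, 1] : h(a, b) ≤ c}` of `h(a, ·)`, for
`a ∈ [0, 1]` and `c ≥ 0`; it satisfies `h⁻¹(h(a, b); a) = b` for `b ≥ a`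
(see `klInv_eq_of_klBin_eq`). -/
def klInv (c a : ℝ) : ℝ :=
  sSup {b : ℝ | b ∈ Set.Icc a 1 ∧ klBin a b ≤ (c : EReal)}

/-- The inverse of the binomial distribution function in its success probability:
`Φ_bin⁻¹(q; n, r) = sup {p ∈ [0, 1] : ℙ(Bin(n, p) ≤ ⌈n r⌉) ≥ q}`. -/
def binInv (q : ℝ) (n : ℕ) (r : ℝ) : ℝ :=
  sSup {x : ℝ | ∃ p : unitInterval, (p : ℝ) = x ∧ q ≤ (binomial n p).real (Set.Iic ⌈n * r⌉₊)}

/-- Empirical mean `R̂ = (1 / N) ∑ᵢ rᵢ` of the calibration risks. -/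
def empMean {N : ℕ} (r : Fin N → ℝ) : ℝ :=
  (∑ i, r i) / N

/-- Unbiased variance estimate `V̂ = 1 / (N (N - 1)) ∑_{i < j} (rᵢ - rⱼ)²`. -/
def empVar {N : ℕ} (r : Fin N → ℝ) : ℝ :=
  1 / ((N : ℝ) * ((N : ℝ) - 1)) * ∑ i, ∑ j ∈ Finset.Ioi i, (r i - r j) ^ 2

/-- The bound `R̄_ρ` on the empirical risk under a shift of radius `ρ`. -/
def riskBound {N : ℕ} (ρ δ : ℝ) (r : Fin N → ℝ) : ℝ :=
  empMean r + ρ ^ 2 * (2 - ρ ^ 2) * (1 - empMean r)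
    + 2 * ρ * (1 - ρ ^ 2) * √(2 - ρ ^ 2) * √(empVar r)
    + (1 - ρ ^ 2) * ((1 - ρ ^ 2) / √(2 * N) + 2 * √2 * ρ * √(2 - ρ ^ 2) / √((N : ℝ) - 1))
        * √(Real.log (4 / δ))
    + √(Real.log (8 / δ) / (2 * N))

/-- The conformal generation risk
`α̂(ρ) = min {h⁻¹(ln (8 / δ) / N; R̄_ρ), Φ_bin⁻¹(δ / (8 e); N, R̄_ρ)}`. As `h(a, ·)` makes sense only
for `a ≤ 1`, a value `R̄_ρ > 1` is replaced by `1` (then `α̂(ρ) = 1`, the trivial bound). -/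
def conformalRisk {N : ℕ} (ρ δ : ℝ) (r : Fin N → ℝ) : ℝ :=
  min (klInv (Real.log (8 / δ) / N) (min (riskBound ρ δ r) 1))
    (binInv (δ / (8 * Real.exp 1)) N (min (riskBound ρ δ r) 1))

/-- The smallness condition on the radius `ρ`, in terms of the calibration risks. -/
def RadiusCondition {N : ℕ} (ρ δ : ℝ) (r : Fin N → ℝ) : Prop :=
  ρ ^ 2 ≤ 1 - (1 + ((empMean r - 1 + √(Real.log (4 / δ) / (2 * N)))
    / (√(empVar r) + √(2 * Real.log (2 / δ) / ((N : ℝ) - 1)))) ^ 2) ^ (-2 : ℤ)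

/-- `h(a, ·)` is strictly increasing on `[a, 1)`. -/
theorem klBin_lt {a b b' : ℝ} (ha : 0 < a) (hab : a ≤ b) (hbb : b < b') (hb' : b' < 1) :
    a * Real.log (a / b) + (1 - a) * Real.log ((1 - a) / (1 - b))
      < a * Real.log (a / b') + (1 - a) * Real.log ((1 - a) / (1 - b')) := by
  have hb : 0 < b := by linarith
  have hb0 : 0 < b' := by linarith
  have h1 : 0 < 1 - b' := by linarith
  have h2 : 0 < 1 - b := by linarith
  have h3 : 0 < 1 - a := by linarith
  rw [Real.log_div ha.ne' hb.ne', Real.log_div ha.ne' hb0.ne', Real.log_div h3.ne' h2.ne',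
    Real.log_div h3.ne' h1.ne']
  have e1 : Real.log (b' / b) ≤ b' / b - 1 := Real.log_le_sub_one_of_pos (by positivity)
  have e2 : Real.log ((1 - b') / (1 - b)) < (1 - b') / (1 - b) - 1 :=
    Real.log_lt_sub_one_of_pos (by positivity) (by rw [ne_eq, div_eq_one_iff_eq h2.ne']; linarith)
  rw [Real.log_div hb0.ne' hb.ne'] at e1
  rw [Real.log_div h1.ne' h2.ne'] at e2
  have e3 : a * (b' / b - 1) + (1 - a) * ((1 - b') / (1 - b) - 1) ≤ 0 := by
    have : a * (b' / b - 1) + (1 - a) * ((1 - b') / (1 - b) - 1)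
        = - ((b' - b) * (b - a) / (b * (1 - b))) := by
      field_simp
      ring
    rw [this, neg_nonpos]
    exact div_nonneg (mul_nonneg (by linarith) (by linarith)) (by positivity)
  nlinarith [mul_le_mul_of_nonneg_left e1 ha.le, mul_lt_mul_of_pos_left e2 h3]

/-- The defining property of the partial inverse: `h⁻¹(h(a, b); a) = b`. -/
theorem klInv_eq_of_klBin_eq {a b c : ℝ} (ha : 0 < a) (hab : a ≤ b) (hb : b < 1)
    (hc : klBin a b = c) : klInv c a = b := by
  have hval : ∀ x, a ≤ x → x < 1 → klBin a x
      = ((a * Real.log (a / x) + (1 - a) * Real.log ((1 - a) / (1 - x)) : ℝ) : EReal) := by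
    intro x hx hx1
    refine if_neg ?_
    rintro (⟨h, -⟩ | ⟨h, -⟩) <;> linarith
  have hub : ∀ x ∈ {x : ℝ | x ∈ Set.Icc a 1 ∧ klBin a x ≤ (c : EReal)}, x ≤ b := by
    rintro x ⟨⟨hx, hx1⟩, hxc⟩
    by_contra! hbx
    rcases hx1.lt_or_eq with h | h
    · rw [← hc, hval x hx h, hval b hab hb, EReal.coe_le_coe_iff] at hxc
      exact absurd (klBin_lt ha hab hbx h) (not_lt.mpr hxc)
    · have : klBin a x = ⊤ := if_pos (Or.inr ⟨h, by linarith⟩)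
      rw [this, top_le_iff] at hxc
      exact EReal.coe_ne_top c hxc
  have hmem : b ∈ {x : ℝ | x ∈ Set.Icc a 1 ∧ klBin a x ≤ (c : EReal)} :=
    ⟨⟨hab, hb.le⟩, hc.le⟩
  exact le_antisymm (csSup_le ⟨b, hmem⟩ hub) (le_csSup ⟨b, hub⟩ hmem)

end

end ConformalShift

/-!
The risk `f z = R (T z.1) z.2` takes values in `[0, 1]`, and the claim combines a bound on its
integral under every `Q` in a Hellinger ball around `D` with two concentration inequalities.

*Shift.* With `φ = √(dD/dμ)` and `ψ = √(dQ/dμ)`, unit vectors of `L²(μ)` with inner product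
`A = 1 - H(D, Q)²`, write `ψ = A φ + w` with `w ⟂ φ`. Expanding `∫ f ψ² dμ` and applying
Cauchy-Schwarz to the cross term gives `Q[f] ≤ A² m + 2 A √(1 - A²) σ + (1 - A²)`, where `m` and
`σ` are the mean and the standard deviation of `f` under `D`. Together with `Q[f] ≤ 1`, this remains
true when `A` is replaced by any smaller number in `[0, 1]`, in particular by `1 - ρ²`
(`le_of_affinity_le`, `integral_le_of_hellinger_le`). The condition on the radius serves only to
ensure `ρ < 1` here.

*Concentration.* The mean is estimated by Hoeffding's inequality. For the standard deviation,
`√v ≤ √V̂ + √(2 L / (N - 1))` with probability at least `1 - exp (-L)`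
(`measureReal_sqrt_empVar_lt_le`). The estimate `V̂` is a U-statistic with the kernel
`(x - y)² / 2 ∈ [0, 1 / 2]`, so it is the average over all permutations of averages over
`k = ⌊N / 2⌋` disjoint, hence independent, pairs. Jensen's inequality reduces its exponential moment
to that of one such average, and `exp (-x) ≤ 1 - x + x² / 2` yields the lower tail
`ℙ(V̂ ≤ v - u) ≤ exp (-k u² / v)`, where `2 k ≥ N - 1`. Each of the two inequalities is used with
`exp (-L) = δ / 4`.

*Inversion.* Both events being excluded, `Q[f] + √(log (8 / δ) / (2 N)) ≤ riskBound`. The inverse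
`klInv c a` is at least `a`, and by Chebyshev's inequality for the binomial distribution the margin
`√(log (8 / δ) / (2 N))` puts `Q[f]` below `binInv`, because `δ / (8 e) ≤ 1 / 2`
(`le_conformalRisk`).
-/

namespace ConformalShift

/-! ### Expectations over a Hellinger ball -/

/-- The Cauchy-Schwarz inequality for real-valued functions in `L²(μ)`. -/
theorem integral_mul_le_sqrt_mul_sqrt {α : Type*} [MeasurableSpace α] {μ : Measure α}
    {g h : α → ℝ} (hg : MemLp g 2 μ) (hh : MemLp h 2 μ) :
    ∫ x, g x * h x ∂μ ≤ √(∫ x, g x ^ 2 ∂μ) * √(∫ x, h x ^ 2 ∂μ) := by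
  have hgh : Integrable (fun x => g x * h x) μ := hg.integrable_mul hh
  have hdisc : discrim (∫ x, g x ^ 2 ∂μ) (2 * ∫ x, g x * h x ∂μ) (∫ x, h x ^ 2 ∂μ) ≤ 0 := by
    refine discrim_le_zero fun t => ?_
    have key : (∫ x, g x ^ 2 ∂μ) * (t * t) + 2 * (∫ x, g x * h x ∂μ) * t + ∫ x, h x ^ 2 ∂μ
        = ∫ x, (t * g x + h x) ^ 2 ∂μ := by
      have : ∀ x, (t * g x + h x) ^ 2 = t ^ 2 * g x ^ 2 + 2 * t * (g x * h x) + h x ^ 2 :=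
        fun x => by ring
      simp_rw [this]
      rw [integral_add ((hg.integrable_sq.const_mul _).fun_add (hgh.const_mul _)) hh.integrable_sq,
        integral_add (hg.integrable_sq.const_mul _) (hgh.const_mul _),
        integral_const_mul, integral_const_mul]
      ring
    rw [key]
    exact integral_nonneg fun x => sq_nonneg _
  rw [← Real.sqrt_mul (integral_nonneg fun x => sq_nonneg _)]
  apply Real.le_sqrt_of_sq_le
  rw [discrim] at hdisc
  linarith

/-- For unit vectors `φ`, `ψ` of `L²(μ)` with inner product `A`, the quadratic form of multiplication
by `f` at `ψ` is bounded through its mean `m` and variance `v` at `φ`: write `ψ = A φ + w` with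
`w ⟂ φ` and `‖w‖² = 1 - A²`, and bound the cross term by Cauchy-Schwarz after replacing `f` with
`f - m`, which changes nothing because `w ⟂ φ`. -/
theorem integral_mul_sq_le_of_integral_mul_eq {α : Type*} [MeasurableSpace α] {μ : Measure α}
    {f φ ψ : α → ℝ} {A m v : ℝ} (hf : Measurable f) (hf01 : ∀ x, f x ∈ Set.Icc (0 : ℝ) 1)
    (hφ : MemLp φ 2 μ) (hψ : MemLp ψ 2 μ) (hφ1 : ∫ x, φ x ^ 2 ∂μ = 1)
    (hψ1 : ∫ x, ψ x ^ 2 ∂μ = 1) (hA : ∫ x, φ x * ψ x ∂μ = A) (hA0 : 0 ≤ A)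
    (hm : ∫ x, f x * φ x ^ 2 ∂μ = m) (hv : ∫ x, (f x - m) ^ 2 * φ x ^ 2 ∂μ = v) :
    ∫ x, f x * ψ x ^ 2 ∂μ ≤ A ^ 2 * m + 2 * A * √(1 - A ^ 2) * √v + (1 - A ^ 2) := by
  -- the component of `ψ` orthogonal to `φ`
  set w : α → ℝ := fun x => ψ x - A * φ x with hw_def
  have hw : MemLp w 2 μ := hψ.sub (hφ.const_mul A)
  have hφψ : Integrable (fun x => φ x * ψ x) μ := hφ.integrable_mul hψ
  have hφw : Integrable (fun x => φ x * w x) μ := hφ.integrable_mul hw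
  have hm01 : ∀ x, ‖f x - m‖ ≤ 1 + |m| := fun x => by
    have := hf01 x
    rw [Real.norm_eq_abs]
    refine (abs_sub _ _).trans ?_
    rw [abs_of_nonneg this.1]
    linarith [this.2]
  have hfφ : MemLp (fun x => (f x - m) * φ x) 2 μ :=
    MemLp.of_le_mul hφ ((hf.sub_const m).aestronglyMeasurable.mul hφ.1)
      (Filter.Eventually.of_forall fun x => by
        rw [norm_mul]
        exact mul_le_mul_of_nonneg_right (hm01 x) (norm_nonneg _))
  have hfφw : Integrable (fun x => (f x - m) * φ x * w x) μ := hfφ.integrable_mul hw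
  have hf1 : ∀ x, ‖f x‖ ≤ 1 := fun x => by
    rw [Real.norm_eq_abs, abs_of_nonneg (hf01 x).1]
    exact (hf01 x).2
  have hfφ2 : Integrable (fun x => f x * φ x ^ 2) μ :=
    hφ.integrable_sq.bdd_mul hf.aestronglyMeasurable (Filter.Eventually.of_forall hf1)
  have hfw2 : Integrable (fun x => f x * w x ^ 2) μ :=
    hw.integrable_sq.bdd_mul hf.aestronglyMeasurable (Filter.Eventually.of_forall hf1)
  have horth : ∫ x, φ x * w x ∂μ = 0 := by
    have : ∀ x, φ x * w x = φ x * ψ x - A * φ x ^ 2 := fun x => by simp only [hw_def]; ring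
    simp_rw [this]
    rw [integral_sub hφψ (hφ.integrable_sq.const_mul _), integral_const_mul, hφ1, hA]
    ring
  have hw2 : ∫ x, w x ^ 2 ∂μ = 1 - A ^ 2 := by
    have : ∀ x, w x ^ 2 = ψ x ^ 2 - 2 * A * (φ x * ψ x) + A ^ 2 * φ x ^ 2 :=
      fun x => by simp only [hw_def]; ring
    simp_rw [this]
    rw [integral_add (by exact hψ.integrable_sq.sub (hφψ.const_mul _)) (hφ.integrable_sq.const_mul _),
      integral_sub hψ.integrable_sq (hφψ.const_mul _), integral_const_mul, integral_const_mul,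
      hφ1, hψ1, hA]
    ring
  have hexp : ∫ x, f x * ψ x ^ 2 ∂μ
      = A ^ 2 * m + 2 * A * (∫ x, (f x - m) * φ x * w x ∂μ) + ∫ x, f x * w x ^ 2 ∂μ := by
    have : ∀ x, f x * ψ x ^ 2 = A ^ 2 * (f x * φ x ^ 2) + 2 * A * ((f x - m) * φ x * w x)
        + 2 * A * m * (φ x * w x) + f x * w x ^ 2 := fun x => by simp only [hw_def]; ring
    simp_rw [this]
    rw [integral_add (((hfφ2.const_mul _).fun_add (hfφw.const_mul _)).fun_add (hφw.const_mul _)) hfw2,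
      integral_add ((hfφ2.const_mul _).fun_add (hfφw.const_mul _)) (hφw.const_mul _),
      integral_add (hfφ2.const_mul _) (hfφw.const_mul _), integral_const_mul, integral_const_mul,
      integral_const_mul, horth, hm]
    ring
  have hcs := integral_mul_le_sqrt_mul_sqrt hfφ hw
  simp_rw [mul_pow] at hcs
  rw [hv, hw2] at hcs
  have hlast : ∫ x, f x * w x ^ 2 ∂μ ≤ 1 - A ^ 2 := by
    rw [← hw2]
    exact integral_mono hfw2 hw.integrable_sq fun x =>
      mul_le_of_le_one_left (sq_nonneg _) (hf01 x).2
  rw [hexp]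
  nlinarith [mul_le_mul_of_nonneg_left hcs hA0]

/-- A bound by `x² m + 2 x √(1 - x²) σ + (1 - x²)` at the affinity `x = A` carries over to every
smaller `c ≥ 0`. The expression need not be antitone in `x`, but its minimum with `1` is. -/
theorem le_of_affinity_le {e m σ A c : ℝ} (hσ : 0 ≤ σ) (hm : m ≤ 1) (hc : 0 ≤ c) (hcA : c ≤ A)
    (he1 : e ≤ 1) (he : e ≤ A ^ 2 * m + 2 * A * √(1 - A ^ 2) * σ + (1 - A ^ 2)) :
    e ≤ c ^ 2 * m + 2 * c * √(1 - c ^ 2) * σ + (1 - c ^ 2) := by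
  -- `1` minus the bound is `x * (x * (1 - m) - 2 * √(1 - x²) * σ)`, and the second factor is
  -- monotone in `x`
  have hmono : c * (1 - m) - 2 * √(1 - c ^ 2) * σ ≤ A * (1 - m) - 2 * √(1 - A ^ 2) * σ := by
    have h1 : √(1 - A ^ 2) ≤ √(1 - c ^ 2) :=
      Real.sqrt_le_sqrt (sub_le_sub_left (pow_le_pow_left₀ hc hcA 2) 1)
    have h2 := mul_le_mul_of_nonneg_right h1 hσ
    have h3 := mul_le_mul_of_nonneg_right hcA (sub_nonneg.2 hm)
    linarith
  rcases le_total (c * (1 - m) - 2 * √(1 - c ^ 2) * σ) 0 with h | h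
  · nlinarith [mul_nonneg hc (neg_nonneg.2 h)]
  · nlinarith [mul_le_mul hcA hmono h (hc.trans hcA)]

theorem memLp_sqrt_rnDeriv {α : Type*} [MeasurableSpace α] (D μ : Measure α) [IsFiniteMeasure D]
    [SigmaFinite μ] : MemLp (fun x => √(D.rnDeriv μ x).toReal) 2 μ := by
  rw [memLp_two_iff_integrable_sq
    (Measure.measurable_rnDeriv D μ).ennreal_toReal.sqrt.aestronglyMeasurable]
  simp_rw [Real.sq_sqrt ENNReal.toReal_nonneg]
  exact Measure.integrable_toReal_rnDeriv

theorem integral_mul_sqrt_rnDeriv_sq {α : Type*} [MeasurableSpace α] {D μ : Measure α}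
    [IsFiniteMeasure D] [SigmaFinite μ] (h : D ≪ μ) (f : α → ℝ) :
    ∫ x, f x * √(D.rnDeriv μ x).toReal ^ 2 ∂μ = ∫ x, f x ∂D := by
  rw [← integral_rnDeriv_smul h]
  simp_rw [Real.sq_sqrt ENNReal.toReal_nonneg, smul_eq_mul, mul_comm]

/-- The squared Hellinger distance is one minus the affinity `∫ √(dD/dμ) √(dQ/dμ) dμ`. -/
theorem hellinger_sq {α : Type*} [MeasurableSpace α] (D Q : Measure α) [IsProbabilityMeasure D]
    [IsProbabilityMeasure Q] :
    hellinger D Q ^ 2 = 1 - ∫ x, √(D.rnDeriv (D + Q) x).toReal * √(Q.rnDeriv (D + Q) x).toReal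
      ∂(D + Q) := by
  have hD := integral_mul_sqrt_rnDeriv_sq
    (Measure.absolutelyContinuous_of_le (Measure.le_add_right (le_refl D)) : D ≪ D + Q) (fun _ => 1)
  have hQ := integral_mul_sqrt_rnDeriv_sq
    (Measure.absolutelyContinuous_of_le (Measure.le_add_left (le_refl Q)) : Q ≪ D + Q) (fun _ => 1)
  have iD := memLp_sqrt_rnDeriv D (D + Q)
  have iQ := memLp_sqrt_rnDeriv Q (D + Q)
  have iDQ := iD.integrable_mul iQ
  simp only [Pi.mul_def] at iDQ
  simp only [one_mul, integral_const, probReal_univ, smul_eq_mul, mul_one] at hD hQ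
  rw [hellinger, Real.sq_sqrt (mul_nonneg (by norm_num) (integral_nonneg fun _ => sq_nonneg _))]
  simp_rw [sub_sq, mul_assoc]
  rw [integral_add (by exact iD.integrable_sq.sub (iDQ.const_mul 2)) iQ.integrable_sq,
    integral_sub iD.integrable_sq (iDQ.const_mul 2), integral_const_mul, hD, hQ]
  ring

/-- The risk under a distribution `Q` within Hellinger distance `ρ` of `D`, bounded in terms of the
mean and the variance of the risk under `D`. No smallness of `ρ` beyond `ρ ≤ 1` is needed, since the
bound omits the negative term `-(1 - (1 - ρ²)²) Var[f] / (1 - D[f])` of the sharp bound, which is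
the one that holds for small `ρ` only. -/
theorem integral_le_of_hellinger_le {α : Type*} [MeasurableSpace α] {D Q : Measure α}
    [IsProbabilityMeasure D] [IsProbabilityMeasure Q] {f : α → ℝ} (hf : Measurable f)
    (hf01 : ∀ x, f x ∈ Set.Icc (0 : ℝ) 1) {ρ : ℝ} (hρ : hellinger D Q ≤ ρ) (hρ1 : ρ ≤ 1) :
    ∫ x, f x ∂Q ≤ (1 - ρ ^ 2) ^ 2 * ∫ x, f x ∂D
      + 2 * (1 - ρ ^ 2) * √(1 - (1 - ρ ^ 2) ^ 2) * √(Var[f; D]) + (1 - (1 - ρ ^ 2) ^ 2) := by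
  have hDμ : D ≪ D + Q := Measure.absolutelyContinuous_of_le (Measure.le_add_right (le_refl D))
  have hQμ : Q ≪ D + Q := Measure.absolutelyContinuous_of_le (Measure.le_add_left (le_refl Q))
  have h0 : 0 ≤ hellinger D Q := Real.sqrt_nonneg _
  have hρ0 : 0 ≤ ρ := h0.trans hρ
  have hsq := hellinger_sq D Q
  have hle : hellinger D Q ^ 2 ≤ ρ ^ 2 := pow_le_pow_left₀ h0 hρ 2
  have hf1 : ∀ (M : Measure α) [IsProbabilityMeasure M], ∫ x, f x ∂M ≤ 1 := fun M _ => by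
    have := integral_mono_of_nonneg (μ := M) (Filter.Eventually.of_forall fun x => (hf01 x).1)
      (integrable_const (1 : ℝ)) (Filter.Eventually.of_forall fun x => (hf01 x).2)
    simpa using this
  refine le_of_affinity_le (Real.sqrt_nonneg _) (hf1 D) (by nlinarith)
    (A := ∫ x, √(D.rnDeriv (D + Q) x).toReal * √(Q.rnDeriv (D + Q) x).toReal ∂(D + Q))
    (by linarith) (hf1 Q) ?_
  have hone : ∀ (M : Measure α) [IsProbabilityMeasure M], M ≪ D + Q →
      ∫ x, √(M.rnDeriv (D + Q) x).toReal ^ 2 ∂(D + Q) = 1 := fun M _ hM => by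
    simpa using integral_mul_sqrt_rnDeriv_sq hM (fun _ => 1)
  rw [← integral_mul_sqrt_rnDeriv_sq hQμ f]
  refine integral_mul_sq_le_of_integral_mul_eq hf hf01 (memLp_sqrt_rnDeriv D (D + Q))
    (memLp_sqrt_rnDeriv Q (D + Q)) (hone D hDμ) (hone Q hQμ) rfl
    (integral_nonneg fun x => mul_nonneg (Real.sqrt_nonneg _) (Real.sqrt_nonneg _))
    (integral_mul_sqrt_rnDeriv_sq hDμ f) ?_
  rw [integral_mul_sqrt_rnDeriv_sq hDμ (fun x => (f x - ∫ x, f x ∂D) ^ 2),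
    variance_eq_integral hf.aemeasurable]

/-! ### Concentration of the empirical variance and mean -/

section Concentration

theorem exp_neg_le_quadratic {x : ℝ} (hx : 0 ≤ x) : Real.exp (-x) ≤ 1 - x + x ^ 2 / 2 := by
  have h := Real.quadratic_le_exp_of_nonneg hx
  rw [Real.exp_neg, inv_le_comm₀ (Real.exp_pos x) (by nlinarith [sq_nonneg (x - 1)])]
  refine le_trans ?_ h
  -- `(1 + x² / 2)² - x² = 1 + x⁴ / 4`
  rw [inv_le_iff_one_le_mul₀ (by nlinarith [sq_nonneg (x - 1)])]
  nlinarith [sq_nonneg (x ^ 2)]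

variable {Ω : Type*} [MeasurableSpace Ω] {P : Measure Ω}

/-- Because `Y² ≤ Y / 2`, the second-order term of the exponential moment is controlled by the mean of
`Y`; this is what makes the deviation of the variance estimate proportional to `√v`. -/
theorem mgf_neg_le_of_mem_Icc_half [IsProbabilityMeasure P] {Y : Ω → ℝ} (hY : AEMeasurable Y P)
    (hY01 : ∀ ω, Y ω ∈ Set.Icc (0 : ℝ) (1 / 2)) {s : ℝ} (hs : 0 ≤ s) :
    mgf Y P (-s) ≤ Real.exp (-s * P[Y] + s ^ 2 * P[Y] / 4) := by
  have hint : Integrable Y P :=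
    Integrable.of_mem_Icc 0 (1 / 2) hY (Filter.Eventually.of_forall hY01)
  have hbound : mgf Y P (-s) ≤ ∫ ω, (1 + (-s + s ^ 2 / 4) * Y ω) ∂P := by
    refine integral_mono_of_nonneg (Filter.Eventually.of_forall fun ω => (Real.exp_pos _).le)
      ((integrable_const _).add (hint.const_mul _)) (Filter.Eventually.of_forall fun ω => ?_)
    have h := exp_neg_le_quadratic (mul_nonneg hs (hY01 ω).1)
    have h2 : Y ω ^ 2 ≤ 1 / 2 * Y ω := by nlinarith [(hY01 ω).1, (hY01 ω).2]
    simp only [neg_mul]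
    nlinarith [mul_le_mul_of_nonneg_left h2 (sq_nonneg s)]
  rw [integral_add (integrable_const _) (hint.const_mul _), integral_const_mul] at hbound
  simp only [integral_const, probReal_univ, smul_eq_mul, mul_one] at hbound
  refine hbound.trans ?_
  have := Real.add_one_le_exp (-s * P[Y] + s ^ 2 * P[Y] / 4)
  linarith

/-- The values of a function `g` on disjoint pairs of independent variables are independent, so the
moment generating function of their sum is a product. -/
theorem mgf_sum_disjoint_pairs {ι κ : Type*} [DecidableEq κ] {X : κ → Ω → ℝ}
    (hX : ∀ i, AEMeasurable (X i) P) (hind : iIndepFun X P) {a b : ι → κ}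
    (hab : Function.Injective (Sum.elim a b)) {g : ℝ × ℝ → ℝ} (hg : Measurable g) (s : Finset ι)
    (t : ℝ) :
    mgf (∑ j ∈ s, fun ω => g (X (a j) ω, X (b j) ω)) P t
      = ∏ j ∈ s, mgf (fun ω => g (X (a j) ω, X (b j) ω)) P t := by
  classical
  have := hind.isProbabilityMeasure
  have hmeas : ∀ j, AEMeasurable (fun ω => g (X (a j) ω, X (b j) ω)) P := fun j =>
    hg.comp_aemeasurable ((hX _).prodMk (hX _))
  induction s using Finset.induction_on with
  | empty => simp
  | insert j s hj ih =>
    rw [Finset.sum_insert hj, Finset.prod_insert hj, ← ih]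
    refine IndepFun.mgf_add' ?_ (hmeas j).aestronglyMeasurable
      (Finset.aemeasurable_sum s fun i _ => hmeas i).aestronglyMeasurable
    have haa : ∀ i i', a i = a i' → i = i' := fun i i' h => by
      simpa using @hab (Sum.inl i) (Sum.inl i') h
    have hbb : ∀ i i', b i = b i' → i = i' := fun i i' h => by
      simpa using @hab (Sum.inr i) (Sum.inr i') h
    have hne : ∀ i i', a i ≠ b i' := fun i i' h => by
      simpa using @hab (Sum.inl i) (Sum.inr i') h
    set S : Finset κ := {a j, b j} with hS
    set T : Finset κ := s.image a ∪ s.image b with hT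
    have hdisj : Disjoint S T := by
      rw [Finset.disjoint_left]
      intro x hx hx'
      simp only [hS, hT, Finset.mem_insert, Finset.mem_singleton, Finset.mem_union,
        Finset.mem_image] at hx hx'
      rcases hx with rfl | rfl <;> rcases hx' with ⟨i, hi, h⟩ | ⟨i, hi, h⟩
      · exact hj (haa _ _ h ▸ hi)
      · exact hne _ _ h.symm
      · exact hne _ _ h
      · exact hj (hbb _ _ h ▸ hi)
    -- extension by zero of a tuple indexed by a finite subset
    let ext : ∀ U : Finset κ, (U → ℝ) → κ → ℝ := fun U y i => if h : i ∈ U then y ⟨i, h⟩ else 0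
    have hext : ∀ U i, Measurable fun y => ext U y i := fun U i => by
      by_cases h : i ∈ U
      · simp only [ext, h, dif_pos]
        exact measurable_pi_apply _
      · simp only [ext, h, dif_neg, not_false_eq_true]
        exact measurable_const
    have hpair : ∀ U i, Measurable fun y => g (ext U y (a i), ext U y (b i)) := fun U i =>
      hg.comp ((hext U _).prodMk (hext U _))
    have hcomp := (hind.indepFun_finset₀ S T hdisj hX).comp (hpair S j)
      (Finset.measurable_sum s fun i _ => hpair T i)
    convert hcomp using 1
    · funext ω
      simp [ext, hS]
    · funext ω
      simp only [Finset.sum_apply, Function.comp_apply]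
      refine Finset.sum_congr rfl fun i hi => ?_
      have h1 : a i ∈ T := Finset.mem_union_left _ (Finset.mem_image_of_mem _ hi)
      have h2 : b i ∈ T := Finset.mem_union_right _ (Finset.mem_image_of_mem _ hi)
      simp [ext, h1, h2]

/-- A double sum as an average over permutations: as the symmetric group is 2-transitive, the sum
`∑ σ, f (σ a) (σ b)` is the same for all pairs `a ≠ b`. -/
theorem sum_sum_eq_card_mul_perm {N : ℕ} {f : Fin N → Fin N → ℝ} (hf : ∀ i, f i i = 0)
    {a b : Fin N} (hab : a ≠ b) :
    (N.factorial : ℝ) * ∑ i, ∑ j, f i j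
      = N * (N - 1) * ∑ σ : Equiv.Perm (Fin N), f (σ a) (σ b) := by
  have htrans : ∀ i j : Fin N, ∑ σ : Equiv.Perm (Fin N), f (σ i) (σ j)
      = if i = j then 0 else ∑ σ : Equiv.Perm (Fin N), f (σ a) (σ b) := by
    intro i j
    split_ifs with hij
    · subst hij
      simp [hf]
    · obtain ⟨τ, h1, h2⟩ := (MulAction.is_two_pretransitive_iff (G := Equiv.Perm (Fin N))).1
        (Equiv.Perm.isMultiplyPretransitive (Fin N) 2) hij hab
      rw [Equiv.Perm.smul_def] at h1 h2
      rw [← Equiv.sum_comp (Equiv.mulRight τ)]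
      simp [h1, h2]
  have hperm : ∀ σ : Equiv.Perm (Fin N), ∑ i, ∑ j, f (σ i) (σ j) = ∑ i, ∑ j, f i j := fun σ => by
    rw [Equiv.sum_comp σ (fun i => ∑ j, f i (σ j))]
    exact Finset.sum_congr rfl fun i _ => Equiv.sum_comp σ (f i)
  calc (N.factorial : ℝ) * ∑ i, ∑ j, f i j
      = ∑ σ : Equiv.Perm (Fin N), ∑ i, ∑ j, f (σ i) (σ j) := by
        simp [hperm, Fintype.card_perm]
    _ = ∑ i, ∑ j, ∑ σ : Equiv.Perm (Fin N), f (σ i) (σ j) := by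
        rw [Finset.sum_comm]
        exact Finset.sum_congr rfl fun i _ => Finset.sum_comm
    _ = _ := by
        have hrow : ∀ i : Fin N, ∀ C : ℝ,
            ∑ j, (if i = j then 0 else C) = (N - 1) * C := fun i C => by
          have : ∀ j, (if i = j then 0 else C) = C - if i = j then C else 0 := fun j => by
            split_ifs <;> simp
          rw [Finset.sum_congr rfl fun j _ => this j, Finset.sum_sub_distrib]
          simp
          ring
        rw [Finset.sum_congr rfl fun i _ => (Finset.sum_congr rfl fun j _ => htrans i j).trans
          (hrow i _)]
        simp
        ring

theorem empVar_eq_sum {N : ℕ} (r : Fin N → ℝ) :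
    empVar r = 1 / ((N : ℝ) * (N - 1)) * ∑ i, ∑ j, (r i - r j) ^ 2 / 2 := by
  rw [empVar]
  congr 1
  have hsplit : ∀ i : Fin N, ∑ j, (r i - r j) ^ 2 / 2
      = ∑ j, (if i < j then (r i - r j) ^ 2 / 2 else 0)
        + ∑ j, (if j < i then (r i - r j) ^ 2 / 2 else 0) := fun i => by
    rw [← Finset.sum_add_distrib]
    refine Finset.sum_congr rfl fun j _ => ?_
    rcases lt_trichotomy i j with h | h | h
    · simp [h, h.not_gt]
    · simp [h]
    · simp [h, h.not_gt]
  have hIoi : ∀ i : Fin N, ∑ j ∈ Finset.Ioi i, (r i - r j) ^ 2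
      = ∑ j, (if i < j then (r i - r j) ^ 2 else 0) := fun i => by
    rw [← Finset.sum_filter]
    exact Finset.sum_congr (by ext; simp) fun _ _ => rfl
  simp_rw [hsplit, hIoi]
  rw [Finset.sum_add_distrib]
  have hswap : ∑ i, ∑ j, (if j < i then (r i - r j) ^ 2 / 2 else 0)
      = ∑ i, ∑ j, (if i < j then (r i - r j) ^ 2 / 2 else 0) := by
    rw [Finset.sum_comm]
    exact Finset.sum_congr rfl fun i _ => Finset.sum_congr rfl fun j _ => by
      rw [sub_sq_comm]
  rw [hswap, ← Finset.sum_add_distrib]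
  refine Finset.sum_congr rfl fun i _ => ?_
  rw [← Finset.sum_add_distrib]
  refine Finset.sum_congr rfl fun j _ => ?_
  split_ifs <;> ring

/-- Hoeffding's decomposition of the U-statistic `empVar`: it is the average over all permutations of
the average of `(x - y)² / 2` over `k` pairs of distinct indices. -/
theorem empVar_eq_avg_perm {N k : ℕ} (hN : 2 ≤ N) (hk : 0 < k) {a b : Fin k → Fin N}
    (hab : ∀ j, a j ≠ b j) (r : Fin N → ℝ) :
    empVar r = ∑ σ : Equiv.Perm (Fin N), (1 / (N.factorial : ℝ))
      * ((1 / (k : ℝ)) * ∑ j, (r (σ (a j)) - r (σ (b j))) ^ 2 / 2) := by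
  have hN0 : (2 : ℝ) ≤ N := by exact_mod_cast hN
  have hfac : (0 : ℝ) < N.factorial := by positivity
  have hk0 : (0 : ℝ) < k := by positivity
  have h1 : ∀ j, ∑ σ : Equiv.Perm (Fin N), (r (σ (a j)) - r (σ (b j))) ^ 2 / 2
      = N.factorial * empVar r := fun j => by
    have := sum_sum_eq_card_mul_perm (f := fun i j => (r i - r j) ^ 2 / 2) (by simp) (hab j)
    rw [empVar_eq_sum]
    have h2 : (N : ℝ) - 1 ≠ 0 := by linarith
    field_simp at this ⊢
    linarith
  rw [← Finset.mul_sum, ← Finset.mul_sum, Finset.sum_comm]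
  simp_rw [h1]
  simp
  field_simp

theorem integral_sq_sub_div_two [IsProbabilityMeasure P] {X Y : Ω → ℝ} (hX : MemLp X 2 P)
    (hY : MemLp Y 2 P) (hXY : IndepFun X Y P) (hm : P[X] = P[Y]) (hv : Var[X; P] = Var[Y; P]) :
    ∫ ω, (X ω - Y ω) ^ 2 / 2 ∂P = Var[X; P] := by
  have h0 : P[X - Y] = 0 := by
    simp only [Pi.sub_apply]
    rw [integral_sub (hX.integrable one_le_two) (hY.integrable one_le_two), hm, sub_self]
  have h1 := variance_of_integral_eq_zero (hX.sub hY).1.aemeasurable h0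
  rw [variance_sub hX hY, hXY.covariance_eq_zero hX hY, ← hv] at h1
  rw [integral_div]
  simp only [Pi.sub_apply] at h1
  rw [← h1]
  ring

/-- The exponential moment of an average over permutations is at most the average of the
exponential moments, and each of these factorizes over the disjoint pairs. -/
theorem mgf_empVar_neg_le {N k : ℕ} (hN : 2 ≤ N) (hk : 0 < k) (hkN : 2 * k ≤ N)
    {X : Fin N → Ω → ℝ} (hX : ∀ i, AEMeasurable (X i) P) (hind : iIndepFun X P)
    (hX01 : ∀ i ω, X i ω ∈ Set.Icc (0 : ℝ) 1) {m v : ℝ} (hm : ∀ i, P[X i] = m)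
    (hv : ∀ i, Var[X i; P] = v) {l : ℝ} (hl : 0 ≤ l) :
    mgf (fun ω => empVar fun i => X i ω) P (-l) ≤ Real.exp (-l * v + l ^ 2 * v / (4 * k)) := by
  have := hind.isProbabilityMeasure
  have hk0 : (0 : ℝ) < k := by positivity
  have hfac : (0 : ℝ) < N.factorial := by positivity
  let a : Fin k → Fin N := fun j => ⟨2 * j, by omega⟩
  let b : Fin k → Fin N := fun j => ⟨2 * j + 1, by omega⟩
  have hab : Function.Injective (Sum.elim a b) := by
    rintro (i | i) (j | j) h <;> simp [a, b, Fin.ext_iff] at h ⊢ <;> omega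
  have hab' : ∀ j, a j ≠ b j := fun j => by simp [a, b]
  let g : ℝ × ℝ → ℝ := fun z => (z.1 - z.2) ^ 2 / 2
  have hg : Measurable g := by fun_prop
  let W : Equiv.Perm (Fin N) → Ω → ℝ := fun σ =>
    ∑ j, fun ω => g (X (σ (a j)) ω, X (σ (b j)) ω)
  have hgm : ∀ i j, AEMeasurable (fun ω => g (X i ω, X j ω)) P := fun i j =>
    hg.comp_aemeasurable ((hX _).prodMk (hX _))
  have hg01 : ∀ i j ω, g (X i ω, X j ω) ∈ Set.Icc (0 : ℝ) (1 / 2) := fun i j ω => by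
    obtain ⟨h1, h2⟩ := hX01 i ω
    obtain ⟨h3, h4⟩ := hX01 j ω
    exact ⟨by positivity, by simp only [g]; nlinarith⟩
  have hL2 : ∀ i, MemLp (X i) 2 P := fun i =>
    memLp_of_bounded (Filter.Eventually.of_forall (hX01 i)) (hX i).aestronglyMeasurable 2
  have hW : ∀ σ, mgf (W σ) P (-(l / k)) ≤ Real.exp (-l * v + l ^ 2 * v / (4 * k)) := fun σ => by
    have hσ : Function.Injective (Sum.elim (fun j => σ (a j)) (fun j => σ (b j))) := by
      have : Sum.elim (fun j => σ (a j)) (fun j => σ (b j)) = σ ∘ Sum.elim a b := by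
        ext x; cases x <;> rfl
      rw [this]
      exact σ.injective.comp hab
    rw [mgf_sum_disjoint_pairs hX hind hσ hg]
    calc ∏ j, mgf (fun ω => g (X (σ (a j)) ω, X (σ (b j)) ω)) P (-(l / k))
        ≤ ∏ _j : Fin k, Real.exp (-(l / k) * v + (l / k) ^ 2 * v / 4) := by
          refine Finset.prod_le_prod (fun j _ => mgf_nonneg) fun j _ => ?_
          have hmean : ∫ ω, g (X (σ (a j)) ω, X (σ (b j)) ω) ∂P = v := by
            rw [← hv (σ (a j))]
            exact integral_sq_sub_div_two (hL2 _) (hL2 _)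
              (hind.indepFun fun h => hab' j (σ.injective h)) (by rw [hm, hm]) (by rw [hv, hv])
          have := mgf_neg_le_of_mem_Icc_half (hgm (σ (a j)) (σ (b j))) (hg01 _ _)
            (s := l / k) (by positivity)
          rwa [hmean] at this
      _ = _ := by
          rw [Finset.prod_const, ← Real.exp_nat_mul, Finset.card_univ, Fintype.card_fin]
          congr 1
          field_simp
  have hWm : ∀ σ, AEMeasurable (W σ) P := fun σ => Finset.aemeasurable_sum _ fun j _ => hgm _ _
  have hW0 : ∀ σ ω, 0 ≤ W σ ω := fun σ ω => by
    simp only [W, Finset.sum_apply]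
    exact Finset.sum_nonneg fun j _ => (hg01 _ _ ω).1
  have hWint : ∀ σ, Integrable (fun ω => Real.exp (-(l / k) * W σ ω)) P := fun σ => by
    refine Integrable.of_mem_Icc 0 1 ((hWm σ).const_mul _).exp
      (Filter.Eventually.of_forall fun ω => ⟨(Real.exp_pos _).le, ?_⟩)
    rw [Real.exp_le_one_iff]
    nlinarith [mul_nonneg (div_nonneg hl hk0.le) (hW0 σ ω)]
  have hjensen : ∀ ω, Real.exp (-l * empVar fun i => X i ω)
      ≤ ∑ σ : Equiv.Perm (Fin N), (1 / (N.factorial : ℝ)) * Real.exp (-(l / k) * W σ ω) :=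
    fun ω => by
      have := convexOn_exp.map_sum_le (t := Finset.univ)
        (w := fun _ : Equiv.Perm (Fin N) => 1 / (N.factorial : ℝ))
        (p := fun σ => -(l / k) * W σ ω) (fun _ _ => by positivity)
        (by simp [Fintype.card_perm, hfac.ne']) (fun _ _ => Set.mem_univ _)
      refine le_trans (le_of_eq ?_) this
      rw [empVar_eq_avg_perm hN hk hab', Finset.mul_sum]
      congr 1
      refine Finset.sum_congr rfl fun σ _ => ?_
      simp only [W, g, Finset.sum_apply, smul_eq_mul]
      ring
  calc mgf (fun ω => empVar fun i => X i ω) P (-l)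
      ≤ ∫ ω, ∑ σ : Equiv.Perm (Fin N), (1 / (N.factorial : ℝ))
          * Real.exp (-(l / k) * W σ ω) ∂P :=
        integral_mono_of_nonneg (Filter.Eventually.of_forall fun ω => (Real.exp_pos _).le)
          (integrable_finsetSum _ fun σ _ => (hWint σ).const_mul _)
          (Filter.Eventually.of_forall hjensen)
    _ = ∑ σ : Equiv.Perm (Fin N), (1 / (N.factorial : ℝ)) * mgf (W σ) P (-(l / k)) := by
        rw [integral_finsetSum _ fun σ _ => (hWint σ).const_mul _]
        exact Finset.sum_congr rfl fun σ _ => integral_const_mul _ _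
    _ ≤ ∑ _σ : Equiv.Perm (Fin N), (1 / (N.factorial : ℝ))
          * Real.exp (-l * v + l ^ 2 * v / (4 * k)) :=
        Finset.sum_le_sum fun σ _ => mul_le_mul_of_nonneg_left (hW σ) (by positivity)
    _ = _ := by
        simp [Fintype.card_perm]
        field_simp

/-- With probability at least `1 - exp (-L)`, the standard deviation exceeds its estimate by at most
`√(2 L / (N - 1))`. -/
theorem measureReal_sqrt_empVar_lt_le {N : ℕ} (hN : 2 ≤ N)
    {X : Fin N → Ω → ℝ} (hX : ∀ i, AEMeasurable (X i) P) (hind : iIndepFun X P)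
    (hX01 : ∀ i ω, X i ω ∈ Set.Icc (0 : ℝ) 1) {m v : ℝ} (hm : ∀ i, P[X i] = m)
    (hv : ∀ i, Var[X i; P] = v) {L : ℝ} (hL : 0 ≤ L) :
    P.real {ω | √(empVar fun i => X i ω) + √(2 * L / ((N : ℝ) - 1)) < √v} ≤ Real.exp (-L) := by
  have := hind.isProbabilityMeasure
  have hN2 : (2 : ℝ) ≤ N := by exact_mod_cast hN
  have hN1 : (0 : ℝ) < (N : ℝ) - 1 := by linarith
  set β : ℝ := √(2 * L / ((N : ℝ) - 1)) with hβ
  have hβ0 : 0 ≤ β := Real.sqrt_nonneg _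
  have hβ2 : β ^ 2 * ((N : ℝ) - 1) = 2 * L := by
    rw [hβ, Real.sq_sqrt (by positivity)]
    field_simp
  rcases le_or_gt v 0 with hv0 | hv0
  · have hempty : {ω | √(empVar fun i => X i ω) + β < √v} = ∅ := by
      ext ω
      simp only [Set.mem_ofPred_eq, Set.mem_empty_iff_false, iff_false, not_lt]
      rw [Real.sqrt_eq_zero_of_nonpos hv0]
      positivity
    rw [hempty, measureReal_empty]
    positivity
  have hV0 : ∀ ω, 0 ≤ empVar fun i => X i ω := fun ω => by
    rw [empVar]
    have : ∀ i j, 0 ≤ (X i ω - X j ω) ^ 2 := fun i j => sq_nonneg _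
    exact mul_nonneg (by positivity)
      (Finset.sum_nonneg fun i _ => Finset.sum_nonneg fun j _ => this i j)
  have hsv : 0 < √v := Real.sqrt_pos.2 hv0
  have hsv2 : √v ^ 2 = v := Real.sq_sqrt hv0.le
  -- the number of disjoint pairs; `N - 1 ≤ 2 k` is where the `N - 1` of the statement comes from
  obtain ⟨k, hk⟩ : ∃ k, k = N / 2 := ⟨_, rfl⟩
  have hk1 : 0 < k := by omega
  have hk0 : (0 : ℝ) < k := by exact_mod_cast hk1
  have hkN : (N : ℝ) - 1 ≤ 2 * k := by
    have : N ≤ 2 * k + 1 := by omega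
    have : (N : ℝ) ≤ 2 * k + 1 := by exact_mod_cast this
    linarith
  -- the minimizer of the exponent in the Chernoff bound
  set l : ℝ := 2 * k * β / √v with hl
  have hl0 : 0 ≤ l := by positivity
  have hmeas : AEMeasurable (fun ω => empVar fun i => X i ω) P := by
    simp only [empVar]
    refine AEMeasurable.const_mul ?_ _
    exact Finset.aemeasurable_fun_sum _ fun i _ => Finset.aemeasurable_fun_sum _ fun j _ =>
      ((hX i).sub (hX j)).pow_const 2
  have hint : Integrable (fun ω => Real.exp (-l * empVar fun i => X i ω)) P := by
    refine Integrable.of_mem_Icc 0 1 (hmeas.const_mul _).exp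
      (Filter.Eventually.of_forall fun ω => ⟨(Real.exp_pos _).le, ?_⟩)
    rw [Real.exp_le_one_iff]
    nlinarith [mul_nonneg hl0 (hV0 ω)]
  calc P.real {ω | √(empVar fun i => X i ω) + β < √v}
      ≤ P.real {ω | (empVar fun i => X i ω) ≤ v - β * √v} := by
        refine measureReal_mono fun ω hω => ?_
        simp only [Set.mem_ofPred_eq] at hω ⊢
        have h0 := Real.sqrt_nonneg (empVar fun i => X i ω)
        have h1 := Real.sq_sqrt (hV0 ω)
        nlinarith
    _ ≤ Real.exp (-(-l) * (v - β * √v)) * mgf (fun ω => empVar fun i => X i ω) P (-l) :=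
        measure_le_le_exp_mul_mgf _ (neg_nonpos.2 hl0) hint
    _ ≤ Real.exp (-(-l) * (v - β * √v)) * Real.exp (-l * v + l ^ 2 * v / (4 * k)) :=
        mul_le_mul_of_nonneg_left
          (mgf_empVar_neg_le hN hk1 (by omega) hX hind hX01 hm hv hl0) (Real.exp_pos _).le
    _ ≤ Real.exp (-L) := by
        rw [← Real.exp_add, Real.exp_le_exp]
        have e1 : l * (β * √v) = 2 * k * β ^ 2 := by
          rw [hl]; field_simp
        have e2 : l ^ 2 * v / (4 * k) = k * β ^ 2 := by
          rw [hl, div_pow, hsv2]; field_simp; ring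
        rw [e2]
        nlinarith [mul_le_mul_of_nonneg_left hkN (sq_nonneg β)]

/-- Hoeffding's inequality for the empirical mean of independent variables with values in `[0, 1]`. -/
theorem measureReal_empMean_lt_le {N : ℕ}
    (hN : 0 < N) {X : Fin N → Ω → ℝ} (hX : ∀ i, AEMeasurable (X i) P) (hind : iIndepFun X P)
    (hX01 : ∀ i ω, X i ω ∈ Set.Icc (0 : ℝ) 1) {m : ℝ} (hm : ∀ i, P[X i] = m)
    {L : ℝ} (hL : 0 ≤ L) :
    P.real {ω | (empMean fun i => X i ω) + √(L / (2 * N)) < m} ≤ Real.exp (-L) := by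
  have := hind.isProbabilityMeasure
  have hN0 : (0 : ℝ) < N := by exact_mod_cast hN
  have hsub : ∀ i ∈ Finset.univ, HasSubgaussianMGF (fun ω => m - X i ω) (1 / 4) P := fun i _ => by
    have h := (hasSubgaussianMGF_of_mem_Icc (hX i) (Filter.Eventually.of_forall (hX01 i))).neg
    have hc : (‖(1 : ℝ) - 0‖₊ / 2) ^ 2 = 1 / 4 := by
      simp only [sub_zero, nnnorm_one]
      norm_num
    rw [hc] at h
    convert h using 1
    funext ω
    simp [hm]
  have hind' : iIndepFun (fun i ω => m - X i ω) P :=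
    hind.comp (fun _ x => m - x) fun _ => by fun_prop
  have hε : (0 : ℝ) ≤ N * √(L / (2 * N)) := by positivity
  have h := HasSubgaussianMGF.measure_sum_ge_le_of_iIndepFun hind' hsub hε
  refine (measureReal_mono fun ω hω => ?_).trans (h.trans (le_of_eq ?_))
  · simp only [Set.mem_ofPred_eq, empMean] at hω ⊢
    rw [Finset.sum_sub_distrib]
    simp only [Finset.sum_const, Finset.card_univ, Fintype.card_fin, nsmul_eq_mul]
    have h1 := mul_le_mul_of_nonneg_left hω.le hN0.le
    rw [mul_add, mul_div_cancel₀ _ hN0.ne'] at h1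
    linarith
  · congr 1
    rw [mul_pow, Real.sq_sqrt (by positivity)]
    simp
    field_simp
    norm_num

end Concentration

/-! ### Lower bounds for the two inverses -/

theorem le_klInv {a c : ℝ} (hc : 0 ≤ c) (ha1 : a ≤ 1) : a ≤ klInv c a := by
  refine le_csSup ⟨1, fun b hb => hb.1.2⟩ ⟨⟨le_rfl, ha1⟩, ?_⟩
  rw [klBin, if_neg (by tauto)]
  have h : ∀ x : ℝ, x * Real.log (x / x) = 0 := fun x => by
    rcases eq_or_ne x 0 with rfl | hx
    · simp
    · simp [div_self hx]
  rw [h, h, add_zero]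
  exact_mod_cast hc

theorem integral_sq_sub_binomial {n : ℕ} (hn : n ≠ 0) (p : unitInterval) :
    ∫ k, ((p : ℝ) - (k : ℝ) / n) ^ 2 ∂(binomial n p) = (p : ℝ) * (1 - p) / n := by
  rw [← bernstein.variance hn p, integral_binomial, ← Nat.range_succ_eq_Iic,
    Finset.sum_range]
  exact Finset.sum_congr rfl fun k _ => by rw [bernstein_apply, bernstein.z, smul_eq_mul, mul_comm]

theorem binomial_real_Ioi_le {n : ℕ} (hn : n ≠ 0) (p : unitInterval) {m : ℕ} {t : ℝ} (ht : 0 < t)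
    (hm : n * ((p : ℝ) + t) ≤ m) : (binomial n p).real (Set.Ioi m) ≤ 1 / (4 * n * t ^ 2) := by
  have hn0 : (0 : ℝ) < n := by positivity
  have h1 := mul_meas_ge_le_integral_of_nonneg (μ := binomial n p)
    (f := fun k : ℕ => ((p : ℝ) - (k : ℝ) / n) ^ 2)
    (Filter.Eventually.of_forall fun k => sq_nonneg _) (integrable_binomial _) (t ^ 2)
  rw [integral_sq_sub_binomial hn] at h1
  have h2 : (binomial n p).real (Set.Ioi m)
      ≤ (binomial n p).real {k : ℕ | t ^ 2 ≤ ((p : ℝ) - (k : ℝ) / n) ^ 2} := by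
    refine measureReal_mono fun k hk => ?_
    have hk' : (m : ℝ) < k := by exact_mod_cast hk
    have : (p : ℝ) + t ≤ (k : ℝ) / n := by
      rw [le_div_iff₀ hn0]
      linarith
    simp only [Set.mem_ofPred_eq]
    nlinarith
  have h3 : (p : ℝ) * (1 - p) / n ≤ 1 / 4 / n := by
    gcongr
    nlinarith [sq_nonneg ((p : ℝ) - 1 / 2)]
  rw [le_div_iff₀ (by positivity)]
  have h4 := (mul_le_mul_of_nonneg_left h2 (sq_nonneg t)).trans (h1.trans h3)
  rw [le_div_iff₀ hn0] at h4
  linarith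

/-- Chebyshev's inequality is enough here: `q` is at most `1 / 2`, and the margin `t` is at least
`1 / √(2 n)`, which is `√2` times the bound `1 / (2 √n)` on the standard deviation of the frequency. For `a ≥ 1` no margin is needed, as a binomial variable never
exceeds `n`. -/
theorem le_binInv {n : ℕ} (hn : n ≠ 0) {p a q t : ℝ} (hp : p ∈ Set.Icc (0 : ℝ) 1) (ht : 0 < t)
    (hpa : p + t ≤ a ∨ 1 ≤ a) (hq : q ≤ 1 / 2) (hnt : 1 ≤ 2 * n * t ^ 2) : p ≤ binInv q n a := by
  have hn0 : (0 : ℝ) < n := by positivity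
  refine le_csSup ⟨1, ?_⟩ ⟨⟨p, hp⟩, rfl, hq.trans ?_⟩
  · rintro _ ⟨x, rfl, -⟩
    exact x.2.2
  have hcompl : (binomial n ⟨p, hp⟩).real (Set.Iic ⌈n * a⌉₊)
      = 1 - (binomial n ⟨p, hp⟩).real (Set.Ioi ⌈n * a⌉₊) := by
    rw [← Set.compl_Iic, probReal_compl_eq_one_sub measurableSet_Iic]
    ring
  rw [hcompl]
  rcases hpa with h | h
  · have h1 := binomial_real_Ioi_le hn ⟨p, hp⟩ ht (m := ⌈n * a⌉₊)
      ((mul_le_mul_of_nonneg_left h hn0.le).trans (Nat.le_ceil _))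
    have h2 : 1 / (4 * n * t ^ 2) ≤ 1 / 2 := by
      rw [div_le_div_iff₀ (by positivity) (by norm_num)]
      linarith
    linarith
  · have hle : ∀ᵐ k ∂(binomial n ⟨p, hp⟩), k ≤ n :=
      ae_le_of_hasLaw_binomial (P := binomial n ⟨p, hp⟩) HasLaw.id
    have h0 : (binomial n ⟨p, hp⟩).real (Set.Ioi ⌈n * a⌉₊) = 0 := by
      rw [measureReal_eq_zero_iff, measure_eq_zero_iff_ae_notMem]
      filter_upwards [hle] with k hk
      have : (n : ℝ) ≤ ⌈n * a⌉₊ := (le_mul_of_one_le_right hn0.le h).trans (Nat.le_ceil _)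
      have : n ≤ ⌈n * a⌉₊ := by exact_mod_cast this
      simp only [Set.mem_Ioi, not_lt]
      omega
    rw [h0]
    norm_num

/-! ### The deterministic bound -/

/-- The deterministic part of the argument: if the mean and the standard deviation under the
calibration law obey their empirical bounds, then so does any `e` that the Hellinger ball allows.
The last term `√(log (8 / δ) / (2 N))` of `riskBound` is the margin that `le_binInv` asks for. -/
theorem le_conformalRisk {N : ℕ} (hN : 2 ≤ N) {δ ρ e m v : ℝ} (hδ0 : 0 < δ) (hδ1 : δ < 1)
    (hρ0 : 0 ≤ ρ) (hρ1 : ρ < 1) (he : e ∈ Set.Icc (0 : ℝ) 1)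
    (hev : e ≤ (1 - ρ ^ 2) ^ 2 * m + 2 * (1 - ρ ^ 2) * √(1 - (1 - ρ ^ 2) ^ 2) * √v
      + (1 - (1 - ρ ^ 2) ^ 2)) {r : Fin N → ℝ}
    (hm : m ≤ empMean r + √(Real.log (4 / δ) / (2 * N)))
    (hv : √v ≤ √(empVar r) + √(2 * Real.log (4 / δ) / ((N : ℝ) - 1))) :
    e ≤ conformalRisk ρ δ r := by
  have hN2 : (2 : ℝ) ≤ N := by exact_mod_cast hN
  have hN1 : (0 : ℝ) < (N : ℝ) - 1 := by linarith
  have hc0 : 0 ≤ 1 - ρ ^ 2 := by nlinarith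
  -- `8 / δ > 8 > e`
  have hlog8 : 1 ≤ Real.log (8 / δ) := by
    rw [Real.le_log_iff_exp_le (by positivity), le_div_iff₀ hδ0]
    nlinarith [Real.exp_one_lt_d9]
  set t : ℝ := √(Real.log (8 / δ) / (2 * N)) with ht
  have ht0 : 0 < t := Real.sqrt_pos.2 (by positivity)
  have hsqrt : √(1 - (1 - ρ ^ 2) ^ 2) = ρ * √(2 - ρ ^ 2) := by
    rw [show 1 - (1 - ρ ^ 2) ^ 2 = ρ ^ 2 * (2 - ρ ^ 2) by ring, Real.sqrt_mul (sq_nonneg ρ),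
      Real.sqrt_sq hρ0]
  have hU : e + t ≤ riskBound ρ δ r := by
    rw [Real.sqrt_div' _ (by positivity)] at hm
    rw [Real.sqrt_div' _ hN1.le, Real.sqrt_mul zero_le_two] at hv
    rw [hsqrt] at hev
    have h1 := mul_le_mul_of_nonneg_left hm (sq_nonneg (1 - ρ ^ 2))
    have h2 := mul_le_mul_of_nonneg_left hv
      (by positivity : 0 ≤ 2 * (1 - ρ ^ 2) * (ρ * √(2 - ρ ^ 2)))
    have h3 : riskBound ρ δ r = (1 - ρ ^ 2) ^ 2
          * (empMean r + √(Real.log (4 / δ)) / √(2 * N))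
        + 2 * (1 - ρ ^ 2) * (ρ * √(2 - ρ ^ 2))
          * (√(empVar r) + √2 * √(Real.log (4 / δ)) / √((N : ℝ) - 1))
        + (1 - (1 - ρ ^ 2) ^ 2) + t := by
      rw [riskBound]
      ring
    linarith
  have hle : e ≤ min (riskBound ρ δ r) 1 := le_min (by linarith) he.2
  refine le_min (hle.trans (le_klInv (by positivity) (min_le_right _ _)))
    (le_binInv (by omega) he ht0 ?_ ?_ ?_)
  · rcases le_total (riskBound ρ δ r) 1 with h | h
    · left; rwa [min_eq_left h]
    · right; rw [min_eq_right h]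
  · rw [div_le_div_iff₀ (by positivity) two_pos]
    nlinarith [Real.add_one_le_exp 1]
  · rw [ht, Real.sq_sqrt (by positivity)]
    field_simp
    exact hlog8

/-- The radius condition implies `ρ < 1`: its right-hand side is `1` minus a positive number, also when
the quotient in it is `x / 0 = 0`. -/
theorem RadiusCondition.lt_one {N : ℕ} {ρ δ : ℝ} {r : Fin N → ℝ} (h : RadiusCondition ρ δ r) :
    ρ < 1 := by
  rw [RadiusCondition] at h
  have : ρ ^ 2 < 1 := h.trans_lt (sub_lt_self _ (by positivity))
  nlinarith

end ConformalShift

theorem mainTheorem1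
    {Ω 𝒳 𝒴 𝒢 : Type*} [MeasurableSpace Ω] [MeasurableSpace 𝒳] [MeasurableSpace 𝒴]
    (P : Measure Ω) [IsProbabilityMeasure P]
    (D Q : Measure (𝒳 × 𝒴)) [IsProbabilityMeasure D] [IsProbabilityMeasure Q]
    (T : 𝒳 → 𝒢) (R : 𝒢 → 𝒴 → ℝ)
    (hRmeas : Measurable fun z : 𝒳 × 𝒴 => R (T z.1) z.2)
    (hR : ∀ g y, R g y ∈ Set.Icc (0 : ℝ) 1)
    (N : ℕ) (hN : 2 ≤ N) (Z : Fin N → Ω → 𝒳 × 𝒴)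
    (hZ : ∀ i, HasLaw (Z i) D P) (hZind : iIndepFun Z P)
    (δ : ℝ) (hδ0 : 0 < δ) (hδ1 : δ < 1)
    (ρ : ℝ) (hρ : ConformalShift.hellinger D Q ≤ ρ) :
    1 - δ ≤ P.real {ω |
      ConformalShift.RadiusCondition ρ δ (fun i => R (T (Z i ω).1) (Z i ω).2) →
        ∫ z, R (T z.1) z.2 ∂Q
          ≤ ConformalShift.conformalRisk ρ δ (fun i => R (T (Z i ω).1) (Z i ω).2)} := by
  set f : 𝒳 × 𝒴 → ℝ := fun z => R (T z.1) z.2 with hf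
  have hf01 : ∀ z, f z ∈ Set.Icc (0 : ℝ) 1 := fun z => hR _ _
  have hX : ∀ i, AEMeasurable (fun ω => f (Z i ω)) P := fun i =>
    hRmeas.comp_aemeasurable (hZ i).aemeasurable
  have hind : iIndepFun (fun i ω => f (Z i ω)) P := hZind.comp (fun _ => f) fun _ => hRmeas
  have hm : ∀ i, P[fun ω => f (Z i ω)] = ∫ z, f z ∂D := fun i =>
    (hZ i).integral_comp hRmeas.aestronglyMeasurable
  have hv : ∀ i, Var[fun ω => f (Z i ω); P] = Var[f; D] := fun i => by
    have hmeas : AEMeasurable f (P.map (Z i)) := hRmeas.aemeasurable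
    have := variance_map hmeas (hZ i).aemeasurable
    rw [(hZ i).map_eq] at this
    exact this.symm
  have hL : 0 ≤ Real.log (4 / δ) := Real.log_nonneg (by rw [le_div_iff₀ hδ0]; linarith)
  have hexp : Real.exp (-Real.log (4 / δ)) = δ / 4 := by
    rw [Real.exp_neg, Real.exp_log (by positivity), inv_div]
  have hmean := ConformalShift.measureReal_empMean_lt_le (by omega) hX hind
    (fun i ω => hf01 _) hm hL
  have hvar := ConformalShift.measureReal_sqrt_empVar_lt_le hN hX hind
    (fun i ω => hf01 _) hm hv hL
  rw [hexp] at hmean hvar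
  have he : ∫ z, f z ∂Q ∈ Set.Icc (0 : ℝ) 1 := by
    refine ⟨integral_nonneg fun z => (hf01 z).1, ?_⟩
    have := integral_mono_of_nonneg (μ := Q) (Filter.Eventually.of_forall fun z => (hf01 z).1)
      (integrable_const (1 : ℝ)) (Filter.Eventually.of_forall fun z => (hf01 z).2)
    simpa using this
  -- outside of the two deviation events, of probability at most `δ / 4` each, the bound holds
  set S := {ω | ConformalShift.RadiusCondition ρ δ (fun i => f (Z i ω)) →
    ∫ z, f z ∂Q ≤ ConformalShift.conformalRisk ρ δ (fun i => f (Z i ω))} with hS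
  have hcover : (Set.univ : Set Ω) ⊆ S
      ∪ {ω | (ConformalShift.empMean fun i => f (Z i ω)) + √(Real.log (4 / δ) / (2 * N))
          < ∫ z, f z ∂D}
      ∪ {ω | √(ConformalShift.empVar fun i => f (Z i ω)) + √(2 * Real.log (4 / δ) / ((N : ℝ) - 1))
          < √(Var[f; D])} := by
    intro ω _
    by_cases h1 : (ConformalShift.empMean fun i => f (Z i ω)) + √(Real.log (4 / δ) / (2 * N))
        < ∫ z, f z ∂D
    · exact Or.inl (Or.inr h1)
    by_cases h2 : √(ConformalShift.empVar fun i => f (Z i ω))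
        + √(2 * Real.log (4 / δ) / ((N : ℝ) - 1)) < √(Var[f; D])
    · exact Or.inr h2
    refine Or.inl (Or.inl fun hcond => ?_)
    have hρ0 : 0 ≤ ρ := (Real.sqrt_nonneg _).trans hρ
    exact ConformalShift.le_conformalRisk hN hδ0 hδ1 hρ0 hcond.lt_one he
      (ConformalShift.integral_le_of_hellinger_le hRmeas hf01 hρ hcond.lt_one.le)
      (not_lt.1 h1) (not_lt.1 h2)
  have htotal := measureReal_mono (μ := P) hcover
  rw [probReal_univ] at htotal
  have hunion := (measureReal_union_le (μ := P) _ _).trans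
    (add_le_add_left (measureReal_union_le (μ := P) S _) _) |> htotal.trans
  linarith
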